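/- Setting. There are $K\ge 1$ arms and a time span $\tau_{\max}\ge 1$. Each pull of arm $i$ draws, independently of the past, a vector $(X^i_1,\dots,X^i_{\tau_{\max}})$ of per-round rewards from a law attached to the arm, with $X^i_j\in[0,\overline X^i_j]$ almost surely; the $j$-th reward of a pull made in round $t$ is observed in round $t+j-1$. Put $R^i=\sum_j X^i_j$, $\mu_i=\mathbb E[R^i]$, $\overline R^i=\sum_j\overline X^i_j$, $\mu^*=\max_i\mu_i$, $\Delta_i=\mu^*-\mu_i$, $\overline R_{\max}=\max_i\overline R^i$. Let $\alpha\in\{1,\dots,\tau_{\max}\}$ divide $\tau_{\max}$, $\phi=\tau_{\max}/\alpha$, and $Z^i_k=\sum_{j=(k-1)\phi+1}^{k\phi}X^i_j$ for $1\le k\le\alpha$. The problem is $\alpha$-smooth if for each arm $i$ the variables $Z^i_1,\dots,Z^i_\alpha$ are independent and $\sum_{j=(k-1)\phi+1}^{k\phi}\overline X^i_j=\overline R^i/\alpha$ for every $k$. A (possibly randomized) policy chooses the arm $i_t$ of round $t$ from the past choices and the rewards observed in rounds $1,\dots,t-1$; its pseudo-regret is $\mathcal R_T=T\mu^*-\mathbb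 E[\sum_{t=1}^T\mu_{i_t}]$. It is uniformly efficient on a class of problems if on each problem of the class and for every $a\in(0,1)$ the expected number of pulls of each suboptimal arm in the first $T$ rounds is $o(T^a)$. $KL(p,q)\in[0,\infty]$ denotes the Kullback–Leibler divergence between Bernoulli laws with means $p$ and $q$. Theorem (worst-case lower bound under $\alpha$-smoothness). Consider an $\alpha$-smooth problem in which each suboptimal arm $i$ has $\overline R^i=\overline R_{\max}$ and each $Z^i_k$ $(1\le k\le\alpha)$ equals $\overline R_{\max}/\alpha$ with probability $\mu_i/\overline R_{\max}$ and $0$ otherwise. Then every policy that is uniformly efficient on the class of all $\alpha$-smooth problems with the same maximum per-round rewards $\overline X^i_j$ satisfies on this problem $$\liminf_{T\to\infty}\frac{\mathcal R_T}{\ln T}\;\ge\;\sum_{i:\mu_i<\mu^*}\frac{\Delta_i}{\alpha\,KL\!\left(\frac{\mu_i}{\overline R_{\max}},\frac{\mu^*}{\overline R_{\max}}\right)},$$ where a term with $KL=\infty$ counts as $0$. Moreover, for all $R$ and all $\mu_1,\dots,\mu_K\in[0,R]$ there is such an $\alpha$-smooth problem with means $\mu_1,\dots,\mu_K$ and $\overline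 R^i=R$ for all $i$, in which every $Z^i_k$, for every arm $i$, is of this two-point form; so the bound holds in the worst case over $\alpha$-smooth problems, for all values of the means and of $\overline R_{\max}$. -/

import Mathlib

open MeasureTheory ProbabilityTheory Filter Asymptotics
open scoped ENNReal

/-- The law of a random variable that equals `c` with probability `p` and `0` with
probability `1 - p` (for `0 ≤ p ≤ 1`). -/
noncomputable def scaledBernoulli (c p : ℝ) : Measure ℝ :=
  ENNReal.ofReal (1 - p) • Measure.dirac 0 + ENNReal.ofReal p • Measure.dirac c

/-- Kullback–Leibler divergence, with values in `[0, ∞]`, between the Bernoulli laws with means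
`p` and `q`. -/
noncomputable def bernoulliKL (p q : ℝ) : ℝ≥0∞ :=
  InformationTheory.klDiv (scaledBernoulli 1 p) (scaledBernoulli 1 q)

/-- For `α` dividing `Tmax` and `φ = Tmax / α`: the sum of the `k`-th group of `φ` consecutive
entries of a vector of per-round rewards. Indices start at `0`. -/
noncomputable def blockSum {Tmax : ℕ} (α : ℕ) (k : Fin α) (x : Fin Tmax → ℝ) : ℝ :=
  ∑ j ∈ Finset.univ.filter (fun j : Fin Tmax =>
    (k : ℕ) * (Tmax / α) ≤ (j : ℕ) ∧ (j : ℕ) < ((k : ℕ) + 1) * (Tmax / α)), x j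

/-- A stochastic bandit problem with temporally-partitioned rewards: each pull of arm `i` draws,
independently of the past, a vector of `Tmax` per-round rewards from `law i`; the `j`-th entry
takes values in `[0, cap i j]`. -/
structure TPMAB (K Tmax : ℕ) where
  /-- maximum per-round rewards -/
  cap : Fin K → Fin Tmax → ℝ
  /-- joint law of the per-round rewards of one pull of an arm -/
  law : Fin K → Measure (Fin Tmax → ℝ)
  isProbabilityMeasure_law : ∀ i, IsProbabilityMeasure (law i)
  ae_mem_Icc : ∀ i, ∀ᵐ x ∂(law i), ∀ j, x j ∈ Set.Icc 0 (cap i j)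

namespace TPMAB

variable {K Tmax : ℕ}

/-- Expected cumulative reward of a pull of arm `i`. -/
noncomputable def mean (P : TPMAB K Tmax) (i : Fin K) : ℝ := ∫ x, ∑ j, x j ∂(P.law i)

/-- Expected cumulative reward of an optimal arm. -/
noncomputable def bestMean (P : TPMAB K Tmax) : ℝ := ⨆ i, P.mean i

/-- Maximum cumulative reward of a pull of arm `i`. -/
noncomputable def maxReward (P : TPMAB K Tmax) (i : Fin K) : ℝ := ∑ j, P.cap i j

/-- Largest maximum cumulative reward over the arms. -/
noncomputable def maxRewardSup (P : TPMAB K Tmax) : ℝ := ⨆ i, P.maxReward i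

/-- `α`-smoothness: `α ∈ {1, …, Tmax}` divides `Tmax`, and for each arm the `α` aggregated rewards
of a pull are independent and each has maximum value `maxReward i / α`. -/
def AlphaSmooth (P : TPMAB K Tmax) (α : ℕ) : Prop :=
  1 ≤ α ∧ α ≤ Tmax ∧ α ∣ Tmax ∧
    ∀ i, iIndepFun (fun k : Fin α => (blockSum α k : (Fin Tmax → ℝ) → ℝ)) (P.law i) ∧
      ∀ k : Fin α, blockSum α k (P.cap i) = P.maxReward i / α

/-- The problems that are `α`-smooth and have the given maximum per-round rewards. -/
def alphaSmoothClass (α : ℕ) (cap : Fin K → Fin Tmax → ℝ) : Set (TPMAB K Tmax) :=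
  {P | P.AlphaSmooth α ∧ P.cap = cap}

/-- Arm `i` attains the largest maximum reward `R` of the problem, and each of its `α` aggregated
rewards takes the values `0` and `R / α` only, with mean `P.mean i / α`. -/
def IsScaledBernoulliArm (P : TPMAB K Tmax) (α : ℕ) (i : Fin K) : Prop :=
  P.maxReward i = P.maxRewardSup ∧
    ∀ k : Fin α, (P.law i).map (blockSum α k) =
      scaledBernoulli (P.maxRewardSup / α) (P.mean i / P.maxRewardSup)

/-- The law of the reward vector of a pull, as a kernel in the pulled arm. -/
noncomputable def armKernel (P : TPMAB K Tmax) : Kernel (Fin K) (Fin Tmax → ℝ) :=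
  ⟨P.law, measurable_from_top⟩

end TPMAB

/-- Histories of `t` rounds (numbered `0, …, t - 1`): the pulled arms and the full reward vectors
that these pulls generate. -/
abbrev History (K Tmax t : ℕ) : Type := Fin t → Fin K × (Fin Tmax → ℝ)

/-- What the learner has seen before choosing the arm of round `t`: entry `j` of the reward vector
of round `s` is received in round `s + j`; entries not yet received are replaced by `0`. -/
noncomputable def observed {K Tmax t : ℕ} (h : History K Tmax t) : History K Tmax t :=
  fun s => ((h s).1, fun j => if (s : ℕ) + (j : ℕ) < t then (h s).2 j else 0)

theorem measurable_observed {K Tmax t : ℕ} :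
    Measurable (observed : History K Tmax t → History K Tmax t) := by
  refine measurable_pi_lambda _ fun s => Measurable.prodMk (by fun_prop) ?_
  refine measurable_pi_lambda _ fun j => ?_
  by_cases hj : (s : ℕ) + (j : ℕ) < t
  · simp only [hj, if_true]; fun_prop
  · simp only [hj, if_false]; fun_prop

/-- A (possibly randomized) policy: for each round `t`, the conditional law of the chosen arm given
the record of past choices and observations. -/
structure Policy (K Tmax : ℕ) where
  choice : (t : ℕ) → Kernel (History K Tmax t) (Fin K)
  isMarkovKernel_choice : ∀ t, IsMarkovKernel (choice t)

namespace Policy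

variable {K Tmax : ℕ}

/-- One round of interaction: the policy chooses an arm on the basis of the observed part of the
history, then the reward vector is drawn from the law of that arm. -/
noncomputable def step (π : Policy K Tmax) (P : TPMAB K Tmax) (t : ℕ) :
    Kernel (History K Tmax t) (Fin K × (Fin Tmax → ℝ)) :=
  (π.choice t).comap observed measurable_observed ⊗ₖ Kernel.prodMkLeft _ P.armKernel

/-- Law of the first `t` rounds when the policy is applied to the problem. -/
noncomputable def historyLaw (π : Policy K Tmax) (P : TPMAB K Tmax) :
    (t : ℕ) → Measure (History K Tmax t)
  | 0 => Measure.dirac Fin.elim0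
  | t + 1 => (historyLaw π P t ⊗ₘ π.step P t).map
      fun p => (Fin.snoc p.1 p.2 : History K Tmax (t + 1))

/-- Expected number of pulls of arm `i` in the first `T` rounds. -/
noncomputable def expectedPulls (π : Policy K Tmax) (P : TPMAB K Tmax) (i : Fin K) (T : ℕ) : ℝ :=
  ∫ h, ∑ t : Fin T, (if (h t).1 = i then (1 : ℝ) else 0) ∂(π.historyLaw P T)

/-- Pseudo-regret after `T` rounds. -/
noncomputable def regret (π : Policy K Tmax) (P : TPMAB K Tmax) (T : ℕ) : ℝ :=
  T * P.bestMean - ∫ h, ∑ t : Fin T, P.mean (h t).1 ∂(π.historyLaw P T)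

/-- A policy is uniformly efficient on a class of problems if on each of them it pulls every
suboptimal arm `o(T ^ a)` times in expectation, for every `a ∈ (0, 1)`. -/
def UniformlyEfficientOn (π : Policy K Tmax) (C : Set (TPMAB K Tmax)) : Prop :=
  ∀ P ∈ C, ∀ i, P.mean i < P.bestMean → ∀ a : ℝ, 0 < a → a < 1 →
    (fun T : ℕ => π.expectedPulls P i T) =o[atTop] fun T : ℕ => (T : ℝ) ^ a

end Policy

/-!
The lower bound is a change-of-measure argument. Fix a suboptimal arm `i` and replace its law so
that it becomes the unique optimal arm (`exists_alternative`). A uniformly efficient policy pulls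
`i` only `o(T ^ a)` times in the original problem, but all except `o(T ^ a)` times in the
alternative one. Telling the two problems apart this reliably costs about `log T` units of
information, and each pull of `i` supplies at most the divergence between the two laws of the arm.

Two facts make the cost of a pull equal to `α * KL`. The block sums take only the values `0` and
their maximum, and in both cases all rewards of the block are forced, so the law of the whole
reward vector is the image of a product of `α` Bernoulli laws (`eq_bernoulliBlockLaw`). The
alternative has the same form, with success probability slightly above the optimal one, hence
stays in the class of smooth problems, and the divergence of products is additive.

Information is measured by `EntropyBound`, the Donsker–Varadhan inequality for bounded test
functions with a constant `C` in place of the divergence. It is stable under images, products and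
composition with kernels (`EntropyBound.map`, `EntropyBound.pi`, `EntropyBound.compProd`), so it
passes from a single block to a pull, and by induction on the rounds to the law of the interaction
(`entropyBound_historyLaw`). The test function `l * (1 - N / T)`, with `N` the number of pulls of
`i` and `l = (1 - a) * log T`, turns it into a bound on the expected number of pulls
(`eventually_le_mul_expectedPulls`). Then `a` tends to `0` and the success probability of the
alternative to the optimal one. If the optimal mean equals the largest maximum reward, no
alternative exists, but then the divergence is infinite and the arm contributes `0`.

The worst-case problem pays out whole blocks independently (`bernoulliBlockLaw`), with equal
maximum rewards in all rounds.
-/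

/-! ### The entropy inequality -/

/-- The Donsker–Varadhan form of "the Kullback–Leibler divergence of `μ` from `ν` is at most `C`":
only bounded measurable test functions occur, so no densities or integrability of
log-likelihood ratios have to be carried along. -/
def EntropyBound {X : Type*} [MeasurableSpace X] (μ ν : Measure X) (C : ℝ) : Prop :=
  ∀ f : X → ℝ, Measurable f → (∃ M, ∀ x, |f x| ≤ M) →
    ∫ x, f x ∂μ ≤ Real.log (∫ x, Real.exp (f x) ∂ν) + C

section EntropyBound

variable {X Y : Type*} [MeasurableSpace X] [MeasurableSpace Y]

theorem integrable_of_measurable_of_abs_le {μ : Measure X} [IsFiniteMeasure μ] {f : X → ℝ}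
    (hf : Measurable f) {M : ℝ} (hM : ∀ x, |f x| ≤ M) : Integrable f μ :=
  Integrable.of_bound hf.aestronglyMeasurable M (Eventually.of_forall hM)

theorem integrable_exp_of_abs_le {μ : Measure X} [IsFiniteMeasure μ] {f : X → ℝ}
    (hf : Measurable f) {M : ℝ} (hM : ∀ x, |f x| ≤ M) :
    Integrable (fun x => Real.exp (f x)) μ :=
  integrable_of_measurable_of_abs_le (M := Real.exp M) hf.exp fun x => by
    rw [abs_of_pos (Real.exp_pos _)]
    exact Real.exp_le_exp.2 ((le_abs_self _).trans (hM x))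

theorem exp_neg_le_integral_exp {μ : Measure X} [IsProbabilityMeasure μ] {f : X → ℝ}
    (hf : Measurable f) {M : ℝ} (hM : ∀ x, |f x| ≤ M) :
    Real.exp (-M) ≤ ∫ x, Real.exp (f x) ∂μ := by
  have h := integral_mono (μ := μ) (integrable_const (Real.exp (-M)))
    (integrable_exp_of_abs_le hf hM)
    fun x => Real.exp_le_exp.2 (neg_le_of_abs_le (hM x))
  simpa using h

theorem integral_exp_le_exp {μ : Measure X} [IsProbabilityMeasure μ] {f : X → ℝ}
    (hf : Measurable f) {M : ℝ} (hM : ∀ x, |f x| ≤ M) :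
    ∫ x, Real.exp (f x) ∂μ ≤ Real.exp M := by
  have h := integral_mono (μ := μ) (integrable_exp_of_abs_le hf hM)
    (integrable_const (Real.exp M))
    fun x => Real.exp_le_exp.2 (le_of_abs_le (hM x))
  simpa using h

theorem abs_log_integral_exp_le {μ : Measure X} [IsProbabilityMeasure μ] {f : X → ℝ}
    (hf : Measurable f) {M : ℝ} (hM : ∀ x, |f x| ≤ M) :
    |Real.log (∫ x, Real.exp (f x) ∂μ)| ≤ M := by
  have h1 := exp_neg_le_integral_exp (μ := μ) hf hM
  have h2 := integral_exp_le_exp (μ := μ) hf hM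
  have h0 := (Real.exp_pos (-M)).trans_le h1
  rw [abs_le]
  exact ⟨(Real.le_log_iff_exp_le h0).2 h1, (Real.log_le_iff_le_exp h0).2 h2⟩

theorem EntropyBound.refl (μ : Measure X) [IsProbabilityMeasure μ] : EntropyBound μ μ 0 := by
  rintro f hf ⟨M, hM⟩
  have h0 := (Real.exp_pos (-M)).trans_le (exp_neg_le_integral_exp (μ := μ) hf hM)
  rw [add_zero, Real.le_log_iff_exp_le h0]
  exact convexOn_exp.map_integral_le Real.continuous_exp.continuousOn isClosed_univ
    (Eventually.of_forall fun _ => Set.mem_univ _)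
    (integrable_of_measurable_of_abs_le hf hM) (integrable_exp_of_abs_le hf hM)

theorem EntropyBound.map {μ ν : Measure X} {C : ℝ} (h : EntropyBound μ ν C) {g : X → Y}
    (hg : Measurable g) : EntropyBound (μ.map g) (ν.map g) C := by
  rintro f hf ⟨M, hM⟩
  rw [integral_map hg.aemeasurable hf.aestronglyMeasurable,
    integral_map hg.aemeasurable hf.exp.aestronglyMeasurable]
  exact h (fun x => f (g x)) (hf.comp hg) ⟨M, fun x => hM _⟩

/-- The chain rule: the test function is integrated out fibrewise, and the logarithm of the inner
exponential moment serves as test function for the first marginals. -/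
theorem EntropyBound.compProd {μ ν : Measure X} [IsProbabilityMeasure μ] [IsProbabilityMeasure ν]
    {κ η : Kernel X Y} [IsMarkovKernel κ] [IsMarkovKernel η] {C : ℝ} {c : X → ℝ}
    (h : EntropyBound μ ν C) (hc : Integrable c μ) (hκ : ∀ x, EntropyBound (κ x) (η x) (c x)) :
    EntropyBound (μ ⊗ₘ κ) (ν ⊗ₘ η) (C + ∫ x, c x ∂μ) := by
  rintro f hf ⟨M, hM⟩
  have hfx : ∀ x, Measurable fun y => f (x, y) := fun x => hf.comp measurable_prodMk_left
  have hpos : ∀ x, 0 < ∫ y, Real.exp (f (x, y)) ∂(η x) := fun x =>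
    (Real.exp_pos (-M)).trans_le (exp_neg_le_integral_exp (hfx x) fun y => hM _)
  have hgm : Measurable fun x => Real.log (∫ y, Real.exp (f (x, y)) ∂(η x)) :=
    (StronglyMeasurable.integral_kernel_prod_right' (κ := η)
      (hf.exp.stronglyMeasurable)).measurable.log
  have hgb : ∀ x, |Real.log (∫ y, Real.exp (f (x, y)) ∂(η x))| ≤ M := fun x =>
    abs_log_integral_exp_le (hfx x) fun y => hM _
  have hint := integrable_of_measurable_of_abs_le (μ := μ ⊗ₘ κ) hf hM
  have hinte := integrable_exp_of_abs_le (μ := ν ⊗ₘ η) hf hM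
  have hg := h _ hgm ⟨M, hgb⟩
  simp only [Real.exp_log (hpos _)] at hg
  rw [Measure.integral_compProd hint, Measure.integral_compProd hinte]
  have hle : ∫ x, ∫ y, f (x, y) ∂(κ x) ∂μ ≤
      ∫ x, (Real.log (∫ y, Real.exp (f (x, y)) ∂(η x)) + c x) ∂μ := by
    refine integral_mono ?_ ((integrable_of_measurable_of_abs_le hgm hgb).add hc) fun x =>
      hκ x _ (hfx x) ⟨M, fun y => hM _⟩
    exact hint.integral_compProd
  rw [integral_add (integrable_of_measurable_of_abs_le hgm hgb) hc] at hle
  linarith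

theorem EntropyBound.pi {m m' : Measure X} [IsProbabilityMeasure m] [IsProbabilityMeasure m']
    {C : ℝ} (h : EntropyBound m m' C) (n : ℕ) :
    EntropyBound (Measure.pi fun _ : Fin n => m) (Measure.pi fun _ : Fin n => m') (n * C) := by
  induction n with
  | zero =>
    have : (Measure.pi fun _ : Fin 0 => m) = Measure.pi fun _ : Fin 0 => m' := by
      rw [Measure.pi_of_empty, Measure.pi_of_empty]
    rw [this]
    simpa using EntropyBound.refl (Measure.pi fun _ : Fin 0 => m')
  | succ n ih =>
    have e : ∀ m : Measure X, IsProbabilityMeasure m → (Measure.pi fun _ : Fin (n + 1) => m) =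
        (m ⊗ₘ Kernel.const X (Measure.pi fun _ : Fin n => m)).map
          (MeasurableEquiv.piFinSuccAbove (fun _ => X) 0).symm := by
      intro m _
      rw [Measure.compProd_const]
      exact ((measurePreserving_piFinSuccAbove (fun _ : Fin (n + 1) => m) 0).symm).map_eq.symm
    rw [e m inferInstance, e m' inferInstance]
    have h2 := (h.compProd (κ := Kernel.const X (Measure.pi fun _ : Fin n => m))
      (η := Kernel.const X (Measure.pi fun _ : Fin n => m')) (integrable_const (n * C))
      fun x => by simpa using ih).map
        (MeasurableEquiv.piFinSuccAbove (fun _ => X) 0).symm.measurable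
    convert h2 using 1
    simp
    ring

end EntropyBound

/-! ### Two-point laws -/

section ScaledBernoulli

variable {c p q : ℝ}

theorem isProbabilityMeasure_scaledBernoulli (c : ℝ) (h0 : 0 ≤ p) (h1 : p ≤ 1) :
    IsProbabilityMeasure (scaledBernoulli c p) := by
  constructor
  simp only [scaledBernoulli, Measure.add_apply, Measure.smul_apply, measure_univ, smul_eq_mul,
    mul_one]
  rw [← ENNReal.ofReal_add (by linarith) h0]
  simp

theorem ae_scaledBernoulli (c p : ℝ) : ∀ᵐ x ∂(scaledBernoulli c p), x = 0 ∨ x = c := by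
  rw [scaledBernoulli, ae_add_measure_iff]
  constructor
  · refine Measure.ae_smul_measure ?_ _
    simp [ae_dirac_eq]
  · refine Measure.ae_smul_measure ?_ _
    simp [ae_dirac_eq]

theorem integral_scaledBernoulli (f : ℝ → ℝ) (h0 : 0 ≤ p) (h1 : p ≤ 1) :
    ∫ x, f x ∂(scaledBernoulli c p) = (1 - p) * f 0 + p * f c := by
  have hi : ∀ a : ℝ, Integrable f (Measure.dirac a) := fun a => integrable_dirac (by simp)
  rw [scaledBernoulli, integral_add_measure ((hi _).smul_measure (by simp))
    ((hi _).smul_measure (by simp)), integral_smul_measure, integral_smul_measure,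
    integral_dirac, integral_dirac, ENNReal.toReal_ofReal (by linarith), ENNReal.toReal_ofReal h0]
  simp

/-- Closed form of the divergence between the Bernoulli laws with means `p` and `q`, for `q < 1`;
the convention `0 * log 0 = 0` makes it correct for `p = 0` and `p = 1` as well. -/
noncomputable def klReal (p q : ℝ) : ℝ :=
  p * Real.log (p / q) + (1 - p) * Real.log ((1 - p) / (1 - q))

/-- The inequality `1 + x ≤ exp x` in the form used for the two-point Gibbs inequality, with the
term of the relative entropy vanishing for `a = 0`. -/
theorem mul_le_mul_exp_sub {a b u s : ℝ} (ha : 0 ≤ a) (hb : 0 < b) :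
    a * (u - Real.log (a / b) - s) ≤ b * Real.exp (u - s) - a := by
  rcases ha.eq_or_lt with rfl | ha
  · simp only [zero_mul, sub_zero]; positivity
  · have h := Real.add_one_le_exp (u - Real.log (a / b) - s)
    have e : Real.exp (u - Real.log (a / b) - s) = b / a * Real.exp (u - s) := by
      rw [show u - Real.log (a / b) - s = (u - s) - Real.log (a / b) by ring, Real.exp_sub,
        Real.exp_log (by positivity)]
      field_simp
    rw [e] at h
    have h' := mul_le_mul_of_nonneg_left h ha.le
    have e2 : a * (b / a * Real.exp (u - s)) = b * Real.exp (u - s) := by field_simp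
    rw [e2] at h'
    linarith

theorem entropyBound_scaledBernoulli (c : ℝ) (hp0 : 0 ≤ p) (hp1 : p ≤ 1) (hq0 : 0 < q)
    (hq1 : q < 1) :
    EntropyBound (scaledBernoulli c p) (scaledBernoulli c q) (klReal p q) := by
  rintro f - -
  rw [integral_scaledBernoulli _ hp0 hp1, integral_scaledBernoulli _ hq0.le hq1.le]
  have hq' : 0 < 1 - q := by linarith
  set s := Real.log ((1 - q) * Real.exp (f 0) + q * Real.exp (f c)) with hs
  have hpos : 0 < (1 - q) * Real.exp (f 0) + q * Real.exp (f c) := by positivity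
  have h0 := mul_le_mul_exp_sub (a := 1 - p) (u := f 0) (s := s) (by linarith) hq'
  have h1 := mul_le_mul_exp_sub (a := p) (u := f c) (s := s) hp0 hq0
  have hsum : (1 - q) * Real.exp (f 0 - s) + q * Real.exp (f c - s) = 1 := by
    rw [Real.exp_sub, Real.exp_sub, hs, Real.exp_log hpos]
    field_simp
  unfold klReal
  linarith

theorem klReal_pos (hp0 : 0 ≤ p) (hpq : p < q) (hq1 : q < 1) : 0 < klReal p q := by
  have h1p : 0 < 1 - p := by linarith
  have h1q : 0 < 1 - q := by linarith
  have h1 := mul_le_mul_exp_sub (a := p) (b := q) (u := 0) (s := 0) hp0 (hp0.trans_lt hpq)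
  have hne : (1 - q) / (1 - p) ≠ 1 := by
    rw [Ne, div_eq_one_iff_eq h1p.ne']
    linarith
  have h2 := Real.log_lt_sub_one_of_pos (by positivity) hne
  have h3 := mul_lt_mul_of_pos_left h2 h1p
  have e1 : Real.log ((1 - q) / (1 - p)) = -Real.log ((1 - p) / (1 - q)) := by
    rw [← Real.log_inv, inv_div]
  have e2 : (1 - p) * ((1 - q) / (1 - p) - 1) = (1 - q) - (1 - p) := by field_simp
  rw [e1, e2] at h3
  simp only [zero_sub, sub_zero, Real.exp_zero, mul_one] at h1
  unfold klReal
  linarith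

theorem continuousAt_klReal (hq0 : 0 < q) (hq1 : q < 1) (hp1 : p < 1) :
    ContinuousAt (klReal p) q := by
  rcases eq_or_ne p 0 with rfl | hp
  · unfold klReal
    simp only [zero_mul, sub_zero, zero_add, one_mul]
    have : (1 - q) ≠ 0 := by linarith
    fun_prop (disch := first | assumption | positivity)
  · unfold klReal
    have h1 : (1 - q) ≠ 0 := by linarith
    have h2 : (1 - p) / (1 - q) ≠ 0 := div_ne_zero (by linarith) h1
    have h3 : p / q ≠ 0 := div_ne_zero hp hq0.ne'
    have h4 : q ≠ 0 := hq0.ne'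
    fun_prop (disch := assumption)

/-- The density is also correct for `p = 0`, where it vanishes at `1`. -/
theorem scaledBernoulli_eq_withDensity (p : ℝ) (hq0 : 0 < q) (hq1 : q < 1) :
    scaledBernoulli 1 p = (scaledBernoulli 1 q).withDensity
      fun x => ENNReal.ofReal (if x = 0 then (1 - p) / (1 - q) else p / q) := by
  have hq' : 0 < 1 - q := by linarith
  rw [scaledBernoulli, scaledBernoulli, withDensity_add_measure, withDensity_smul_measure,
    withDensity_smul_measure, dirac_withDensity, dirac_withDensity, smul_smul, smul_smul,
    ← ENNReal.ofReal_mul hq'.le, ← ENNReal.ofReal_mul hq0.le]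
  have e1 : (1 - q) * ((1 - p) / (1 - q)) = 1 - p := by field_simp
  have e2 : q * (p / q) = p := by field_simp
  simp [e1, e2]

theorem bernoulliKL_eq_ofReal (hp0 : 0 ≤ p) (hp1 : p ≤ 1) (hq0 : 0 < q) (hq1 : q < 1) :
    bernoulliKL p q = ENNReal.ofReal (klReal p q) := by
  have := isProbabilityMeasure_scaledBernoulli 1 hp0 hp1
  have := isProbabilityMeasure_scaledBernoulli 1 hq0.le hq1.le
  have hd := scaledBernoulli_eq_withDensity p hq0 hq1
  set g : ℝ → ℝ := fun x => if x = 0 then (1 - p) / (1 - q) else p / q with hg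
  have hgm : Measurable g := Measurable.ite (measurableSet_singleton 0) (by fun_prop) (by fun_prop)
  have hac : scaledBernoulli 1 p ≪ scaledBernoulli 1 q := by
    rw [hd]; exact withDensity_absolutelyContinuous _ _
  have hllr : llr (scaledBernoulli 1 p) (scaledBernoulli 1 q) =ᵐ[scaledBernoulli 1 p]
      fun x => Real.log (g x) := by
    have h1 := Measure.rnDeriv_withDensity (scaledBernoulli 1 q) hgm.ennreal_ofReal
    have h2 := hac.ae_le h1
    filter_upwards [h2] with x hx
    have : (0 : ℝ) ≤ g x := by
      simp only [hg]
      split_ifs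
      · exact div_nonneg (by linarith) (by linarith)
      · positivity
    rw [llr, hd, hx, ENNReal.toReal_ofReal this]
  have hb : ∀ x, |Real.log (g x)| ≤ |Real.log ((1 - p) / (1 - q))| + |Real.log (p / q)| := by
    intro x
    simp only [hg]
    split_ifs
    · linarith [abs_nonneg (Real.log (p / q))]
    · linarith [abs_nonneg (Real.log ((1 - p) / (1 - q)))]
  rw [bernoulliKL, InformationTheory.klDiv_of_ac_of_integrable hac
    ((integrable_congr hllr).2 (integrable_of_measurable_of_abs_le hgm.log hb)),
    integral_congr_ae hllr, integral_scaledBernoulli _ hp0 hp1]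
  simp [hg, klReal, add_comm]

theorem bernoulliKL_one_right (hp1 : p < 1) : bernoulliKL p 1 = ∞ := by
  refine InformationTheory.klDiv_of_not_ac fun h => ?_
  have h1 : scaledBernoulli 1 1 {0} = 0 := by simp [scaledBernoulli]
  have h2 := h h1
  simp only [scaledBernoulli, Measure.add_apply, Measure.smul_apply, smul_eq_mul] at h2
  simp at h2
  linarith

end ScaledBernoulli

/-! ### Arms with independent two-point block sums -/

section Blocks

variable {Tmax α : ℕ}

/-- The block of `Tmax / α` consecutive rounds to which the round `j` of a pull belongs. -/
def blockIndex (hdvd : α ∣ Tmax) (j : Fin Tmax) : Fin α :=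
  ⟨j / (Tmax / α), Nat.div_lt_of_lt_mul (by rw [Nat.div_mul_cancel hdvd]; exact j.2)⟩

theorem blockSum_eq_sum_blockIndex (hdvd : α ∣ Tmax) (k : Fin α) (x : Fin Tmax → ℝ) :
    blockSum α k x = ∑ j with blockIndex hdvd j = k, x j := by
  unfold blockSum
  congr 1
  ext j
  have hpos : 0 < Tmax / α :=
    Nat.div_pos (Nat.le_of_dvd (j.pos) hdvd) (Nat.pos_of_dvd_of_pos hdvd j.pos)
  simp only [Finset.mem_filter, Finset.mem_univ, true_and, blockIndex, Fin.ext_iff]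
  rw [Nat.div_eq_iff hpos]
  rw [add_mul]
  omega

theorem sum_blockSum (hdvd : α ∣ Tmax) (x : Fin Tmax → ℝ) :
    ∑ k : Fin α, blockSum α k x = ∑ j, x j := by
  simp only [blockSum_eq_sum_blockIndex hdvd]
  exact Finset.sum_fiberwise _ _ _

theorem measurable_blockSum (k : Fin α) :
    Measurable (blockSum α k : (Fin Tmax → ℝ) → ℝ) := by
  unfold blockSum
  fun_prop

/-- The per-round rewards with block sums `z`, each `z k` being shared within its block in
proportion to the maximum per-round rewards `cap`, whose sum over each block is `B`. -/
noncomputable def spread (hdvd : α ∣ Tmax) (cap : Fin Tmax → ℝ) (B : ℝ) (z : Fin α → ℝ) :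
    Fin Tmax → ℝ :=
  fun j => cap j / B * z (blockIndex hdvd j)

theorem measurable_spread (hdvd : α ∣ Tmax) (cap : Fin Tmax → ℝ) (B : ℝ) :
    Measurable (spread hdvd cap B) := by
  unfold spread
  fun_prop

/-- The law of the reward vector of a pull in which whole blocks are paid out independently: with
probability `q` all rewards of a block take their maximum, otherwise they all vanish. -/
noncomputable def bernoulliBlockLaw (hdvd : α ∣ Tmax) (cap : Fin Tmax → ℝ) (B q : ℝ) :
    Measure (Fin Tmax → ℝ) :=
  (Measure.pi fun _ : Fin α => scaledBernoulli B q).map (spread hdvd cap B)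

variable {cap : Fin Tmax → ℝ} {B q : ℝ}

/-- The hypothesis on `z k` matters for `B = 0` only, where `spread` divides by zero. -/
theorem blockSum_spread (hdvd : α ∣ Tmax) (hcap : ∀ k : Fin α, blockSum α k cap = B) {z : Fin α → ℝ}
    {k : Fin α} (hz : z k = 0 ∨ z k = B) : blockSum α k (spread hdvd cap B z) = z k := by
  have h : blockSum α k (spread hdvd cap B z) = B / B * z k := by
    rw [show B / B = blockSum α k cap / B by rw [hcap k], blockSum_eq_sum_blockIndex hdvd,
      blockSum_eq_sum_blockIndex hdvd, Finset.sum_div, Finset.sum_mul]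
    refine Finset.sum_congr rfl fun j hj => ?_
    rw [spread, (Finset.mem_filter.1 hj).2]
  rw [h]
  rcases hz with hz | hz <;> rw [hz]
  · simp
  · rw [div_mul_cancel_of_imp]; simp

theorem spread_mem_Icc (hdvd : α ∣ Tmax)
    (hc : ∀ j, 0 ≤ cap j) {z : Fin α → ℝ} (hz : ∀ k, z k = 0 ∨ z k = B)
    (j : Fin Tmax) : spread hdvd cap B z j ∈ Set.Icc 0 (cap j) := by
  unfold spread
  rcases hz (blockIndex hdvd j) with h | h <;> rw [h]
  · simpa using hc j
  · rcases eq_or_ne B 0 with rfl | hB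
    · simpa using hc j
    · rw [div_mul_cancel₀ _ hB]
      exact ⟨hc j, le_rfl⟩

/-- A reward vector within the bounds `cap` is determined by its block sums, if these are extremal:
a block sum `0` forces all rewards of the block to vanish, the maximal one forces all of them to
be maximal. -/
theorem eq_spread (hdvd : α ∣ Tmax)
    (hcap : ∀ k : Fin α, blockSum α k cap = B) (hB : B ≠ 0) {x : Fin Tmax → ℝ}
    (hx : ∀ j, x j ∈ Set.Icc 0 (cap j))
    (hz : ∀ k : Fin α, blockSum α k x = 0 ∨ blockSum α k x = B) :
    x = spread hdvd cap B fun k => blockSum α k x := by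
  ext j
  have hj : j ∈ Finset.univ.filter fun i => blockIndex hdvd i = blockIndex hdvd j := by simp
  change x j = cap j / B * blockSum α (blockIndex hdvd j) x
  rcases hz (blockIndex hdvd j) with h | h
  · rw [h, mul_zero]
    rw [blockSum_eq_sum_blockIndex hdvd, Finset.sum_eq_zero_iff_of_nonneg fun i _ => (hx i).1] at h
    exact h j hj
  · rw [h, div_mul_cancel₀ _ hB]
    rw [← hcap (blockIndex hdvd j), blockSum_eq_sum_blockIndex hdvd,
      blockSum_eq_sum_blockIndex hdvd, Finset.sum_eq_sum_iff_of_le fun i _ => (hx i).2] at h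
    exact h j hj

theorem ae_pi_scaledBernoulli (B : ℝ) (hq0 : 0 ≤ q) (hq1 : q ≤ 1) :
    ∀ᵐ z ∂(Measure.pi fun _ : Fin α => scaledBernoulli B q), ∀ k, z k = 0 ∨ z k = B := by
  have := isProbabilityMeasure_scaledBernoulli B hq0 hq1
  rw [ae_all_iff]
  intro k
  exact (measurePreserving_eval (fun _ : Fin α => scaledBernoulli B q) k).quasiMeasurePreserving.ae
    (ae_scaledBernoulli B q)

theorem isProbabilityMeasure_bernoulliBlockLaw (hdvd : α ∣ Tmax) (hq0 : 0 ≤ q) (hq1 : q ≤ 1) :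
    IsProbabilityMeasure (bernoulliBlockLaw hdvd cap B q) := by
  have := isProbabilityMeasure_scaledBernoulli B hq0 hq1
  exact Measure.isProbabilityMeasure_map (measurable_spread hdvd cap B).aemeasurable

theorem ae_bernoulliBlockLaw_mem_Icc (hdvd : α ∣ Tmax)
    (hc : ∀ j, 0 ≤ cap j) (hq0 : 0 ≤ q) (hq1 : q ≤ 1) :
    ∀ᵐ x ∂(bernoulliBlockLaw hdvd cap B q), ∀ j, x j ∈ Set.Icc 0 (cap j) := by
  rw [bernoulliBlockLaw, ae_map_iff (measurable_spread hdvd cap B).aemeasurable]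
  · filter_upwards [ae_pi_scaledBernoulli B hq0 hq1] with z hz j
    exact spread_mem_Icc hdvd hc hz j
  · simp only [Set.ofPred_forall]
    exact MeasurableSet.iInter fun j => measurable_pi_apply j measurableSet_Icc

theorem map_blockSum_bernoulliBlockLaw (hdvd : α ∣ Tmax)
    (hcap : ∀ k : Fin α, blockSum α k cap = B) (hq0 : 0 ≤ q)
    (hq1 : q ≤ 1) :
    (bernoulliBlockLaw hdvd cap B q).map (fun x (k : Fin α) => blockSum α k x) =
      Measure.pi fun _ : Fin α => scaledBernoulli B q := by
  rw [bernoulliBlockLaw, Measure.map_map (measurable_pi_lambda _ measurable_blockSum)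
    (measurable_spread hdvd cap B)]
  conv_rhs => rw [← Measure.map_id (μ := Measure.pi fun _ : Fin α => scaledBernoulli B q)]
  refine Measure.map_congr ?_
  filter_upwards [ae_pi_scaledBernoulli B hq0 hq1] with z hz
  ext k
  exact blockSum_spread hdvd hcap (hz k)

theorem map_blockSum_bernoulliBlockLaw_apply (hdvd : α ∣ Tmax)
    (hcap : ∀ k : Fin α, blockSum α k cap = B)
    (hq0 : 0 ≤ q) (hq1 : q ≤ 1) (k : Fin α) :
    (bernoulliBlockLaw hdvd cap B q).map (blockSum α k) = scaledBernoulli B q := by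
  have := isProbabilityMeasure_scaledBernoulli B hq0 hq1
  have h := (measurePreserving_eval (fun _ : Fin α => scaledBernoulli B q) k).map_eq
  rw [← map_blockSum_bernoulliBlockLaw hdvd hcap hq0 hq1,
    Measure.map_map (measurable_pi_apply k) (measurable_pi_lambda _ measurable_blockSum)] at h
  exact h

theorem iIndepFun_blockSum_bernoulliBlockLaw (hdvd : α ∣ Tmax)
    (hcap : ∀ k : Fin α, blockSum α k cap = B)
    (hq0 : 0 ≤ q) (hq1 : q ≤ 1) :
    iIndepFun (fun k : Fin α => (blockSum α k : (Fin Tmax → ℝ) → ℝ))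
      (bernoulliBlockLaw hdvd cap B q) := by
  have := isProbabilityMeasure_bernoulliBlockLaw hdvd (cap := cap) (B := B) hq0 hq1
  rw [iIndepFun_iff_map_fun_eq_pi_map fun k => (measurable_blockSum k).aemeasurable,
    map_blockSum_bernoulliBlockLaw hdvd hcap hq0 hq1]
  simp only [map_blockSum_bernoulliBlockLaw_apply hdvd hcap hq0 hq1]

theorem integral_sum_of_map_blockSum (hdvd : α ∣ Tmax)
    {ν : Measure (Fin Tmax → ℝ)} (hq0 : 0 ≤ q) (hq1 : q ≤ 1)
    (h : ∀ k : Fin α, ν.map (blockSum α k) = scaledBernoulli B q) :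
    ∫ x, ∑ j, x j ∂ν = α * (q * B) := by
  have := isProbabilityMeasure_scaledBernoulli B hq0 hq1
  have hi : Integrable (fun y : ℝ => y) (scaledBernoulli B q) := by
    refine Integrable.of_bound (C := |B|) (by fun_prop) ?_
    filter_upwards [ae_scaledBernoulli B q] with y hy
    rcases hy with rfl | rfl <;> simp
  simp only [← sum_blockSum hdvd]
  rw [integral_finsetSum]
  · have : ∀ k : Fin α, ∫ x, blockSum α k x ∂ν = q * B := fun k => by
      have h2 := integral_map (μ := ν) (measurable_blockSum k).aemeasurable
        (f := fun y : ℝ => y) (by fun_prop)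
      rw [← h2, h k, integral_scaledBernoulli _ hq0 hq1]
      simp
    simp [this]
  · intro k _
    rw [← h k] at hi
    exact hi.comp_measurable (measurable_blockSum k)

/-- A scaled Bernoulli arm of a smooth problem with a positive maximum reward has only one
possible law. -/
theorem eq_bernoulliBlockLaw (hdvd : α ∣ Tmax) {ν : Measure (Fin Tmax → ℝ)} [IsProbabilityMeasure ν]
    (hcap : ∀ k : Fin α, blockSum α k cap = B) (hB : B ≠ 0)
    (hx : ∀ᵐ x ∂ν, ∀ j, x j ∈ Set.Icc 0 (cap j))
    (hind : iIndepFun (fun k : Fin α => (blockSum α k : (Fin Tmax → ℝ) → ℝ)) ν)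
    (h : ∀ k : Fin α, ν.map (blockSum α k) = scaledBernoulli B q) :
    ν = bernoulliBlockLaw hdvd cap B q := by
  have hz : ∀ᵐ x ∂ν, ∀ k : Fin α, blockSum α k x = 0 ∨ blockSum α k x = B := by
    rw [ae_all_iff]
    intro k
    have := ae_scaledBernoulli B q
    rw [← h k] at this
    exact ae_of_ae_map (measurable_blockSum k).aemeasurable this
  rw [iIndepFun_iff_map_fun_eq_pi_map fun k => (measurable_blockSum k).aemeasurable] at hind
  simp only [h] at hind
  rw [bernoulliBlockLaw, ← hind, Measure.map_map (measurable_spread hdvd cap B)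
    (measurable_pi_lambda _ measurable_blockSum)]
  conv_lhs => rw [← Measure.map_id (μ := ν)]
  refine Measure.map_congr ?_
  filter_upwards [hx, hz] with x hx hz
  exact eq_spread hdvd hcap hB hx hz

theorem entropyBound_bernoulliBlockLaw (hdvd : α ∣ Tmax)
    {p : ℝ} (hp0 : 0 ≤ p) (hp1 : p ≤ 1) (hq0 : 0 < q)
    (hq1 : q < 1) (cap : Fin Tmax → ℝ) (B : ℝ) :
    EntropyBound (bernoulliBlockLaw hdvd cap B p) (bernoulliBlockLaw hdvd cap B q)
      (α * klReal p q) := by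
  have := isProbabilityMeasure_scaledBernoulli B hp0 hp1
  have := isProbabilityMeasure_scaledBernoulli B hq0.le hq1.le
  exact ((entropyBound_scaledBernoulli B hp0 hp1 hq0 hq1).pi α).map (measurable_spread hdvd cap B)

theorem exists_alphaSmooth_bernoulli (hdvd : α ∣ Tmax)
    {K : ℕ} (hK : 1 ≤ K) (hα : 1 ≤ α) (hT : 1 ≤ Tmax)
    {R : ℝ} {μ : Fin K → ℝ} (hμ : ∀ i, μ i ∈ Set.Icc 0 R) :
    ∃ P : TPMAB K Tmax, P.AlphaSmooth α ∧ P.mean = μ ∧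
      ∀ i, P.maxReward i = R ∧ P.IsScaledBernoulliArm α i := by
  have : Nonempty (Fin K) := ⟨⟨0, hK⟩⟩
  have hR : 0 ≤ R := (hμ ⟨0, hK⟩).1.trans (hμ ⟨0, hK⟩).2
  have hα0 : (α : ℝ) ≠ 0 := by positivity
  have hT0 : (Tmax : ℝ) ≠ 0 := by positivity
  have hle : α ≤ Tmax := Nat.le_of_dvd hT hdvd
  have hφ : 0 < Tmax / α := Nat.div_pos hle hα
  set cap : Fin Tmax → ℝ := fun _ => R / Tmax with hcapdef
  have hc : ∀ j, 0 ≤ cap j := fun _ => by positivity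
  have hsum : ∑ j, cap j = R := by
    simp [hcapdef]; field_simp
  have hcap : ∀ k : Fin α, blockSum α k cap = R / α := by
    intro k
    have hcard : (Finset.univ.filter (fun j : Fin Tmax =>
        (k : ℕ) * (Tmax / α) ≤ (j : ℕ) ∧ (j : ℕ) < ((k : ℕ) + 1) * (Tmax / α))).card =
          Tmax / α := by
      have hk : ((k : ℕ) + 1) * (Tmax / α) ≤ Tmax := by
        calc ((k : ℕ) + 1) * (Tmax / α) ≤ α * (Tmax / α) := Nat.mul_le_mul_right _ k.2
          _ = Tmax := Nat.mul_div_cancel' hdvd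
      rw [← Finset.card_map Fin.valEmbedding]
      have : (Finset.univ.filter (fun j : Fin Tmax =>
        (k : ℕ) * (Tmax / α) ≤ (j : ℕ) ∧ (j : ℕ) < ((k : ℕ) + 1) * (Tmax / α))).map
          Fin.valEmbedding = Finset.Ico ((k : ℕ) * (Tmax / α)) (((k : ℕ) + 1) * (Tmax / α)) := by
        ext n
        simp only [Finset.mem_map, Finset.mem_filter, Finset.mem_univ, true_and, Finset.mem_Ico,
          Fin.valEmbedding_apply]
        exact ⟨fun ⟨j, hj, e⟩ => e ▸ hj, fun hn => ⟨⟨n, hn.2.trans_le hk⟩, hn, rfl⟩⟩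
      rw [this, Nat.card_Ico, add_mul, one_mul, Nat.add_sub_cancel_left]
    unfold blockSum
    rw [Finset.sum_const, hcard, nsmul_eq_mul, Nat.cast_div hdvd hα0]
    field_simp
  have hq0 : ∀ i, 0 ≤ μ i / R := fun i => div_nonneg (hμ i).1 hR
  have hq1 : ∀ i, μ i / R ≤ 1 := fun i => div_le_one_of_le₀ (hμ i).2 hR
  let P : TPMAB K Tmax :=
    { cap := fun _ => cap
      law := fun i => bernoulliBlockLaw hdvd cap (R / α) (μ i / R)
      isProbabilityMeasure_law := fun i =>
        isProbabilityMeasure_bernoulliBlockLaw hdvd (hq0 i) (hq1 i)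
      ae_mem_Icc := fun i => ae_bernoulliBlockLaw_mem_Icc hdvd hc (hq0 i) (hq1 i) }
  have hmax : ∀ i, P.maxReward i = R := fun i => hsum
  have hsup : P.maxRewardSup = R := by
    simp [TPMAB.maxRewardSup, hmax]
  have hmean : P.mean = μ := by
    ext i
    have h := integral_sum_of_map_blockSum hdvd (hq0 i) (hq1 i)
      (map_blockSum_bernoulliBlockLaw_apply hdvd hcap (hq0 i) (hq1 i))
    refine h.trans ?_
    rcases hR.eq_or_lt with rfl | hR
    · have := hμ i
      simp at this
      simp [this]
    · field_simp
  refine ⟨P, ⟨hα, hle, hdvd, fun i => ⟨?_, fun k => ?_⟩⟩, hmean, fun i => ⟨hmax i, ?_, fun k => ?_⟩⟩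
  · exact iIndepFun_blockSum_bernoulliBlockLaw hdvd hcap (hq0 i) (hq1 i)
  · rw [hmax]; exact hcap k
  · rw [hmax, hsup]
  · rw [hsup, hmean]
    exact map_blockSum_bernoulliBlockLaw_apply hdvd hcap (hq0 i) (hq1 i) k

end Blocks

/-! ### The law of the interaction -/

section Interaction

variable {K Tmax : ℕ}

instance (P : TPMAB K Tmax) (i : Fin K) : IsProbabilityMeasure (P.law i) :=
  P.isProbabilityMeasure_law i

instance (P : TPMAB K Tmax) : IsMarkovKernel P.armKernel :=
  ⟨fun i => P.isProbabilityMeasure_law i⟩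

instance (π : Policy K Tmax) (t : ℕ) : IsMarkovKernel (π.choice t) :=
  π.isMarkovKernel_choice t

instance (π : Policy K Tmax) (P : TPMAB K Tmax) (t : ℕ) : IsMarkovKernel (π.step P t) := by
  unfold Policy.step
  infer_instance

theorem measurable_snoc {X : Type*} [MeasurableSpace X] (t : ℕ) :
    Measurable fun p : (Fin t → X) × X => (Fin.snoc p.1 p.2 : Fin (t + 1) → X) := by
  refine measurable_pi_lambda _ fun s => ?_
  induction s using Fin.lastCases with
  | last => simpa using measurable_snd
  | cast s =>
    simp only [Fin.snoc_castSucc]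
    exact (measurable_pi_apply s).comp measurable_fst

instance (π : Policy K Tmax) (P : TPMAB K Tmax) (t : ℕ) :
    IsProbabilityMeasure (π.historyLaw P t) := by
  induction t with
  | zero => unfold Policy.historyLaw; infer_instance
  | succ t ih =>
    unfold Policy.historyLaw
    exact Measure.isProbabilityMeasure_map (measurable_snoc t).aemeasurable

theorem measurable_sum_arm {t : ℕ} (c : Fin K → ℝ) :
    Measurable fun h : History K Tmax t => ∑ s, c (h s).1 :=
  Finset.measurable_sum _ fun s _ =>
    (measurable_of_finite c).comp (measurable_fst.comp (measurable_pi_apply s))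

theorem integrable_sum_arm {t : ℕ} (c : Fin K → ℝ) (μ : Measure (History K Tmax t))
    [IsFiniteMeasure μ] : Integrable (fun h : History K Tmax t => ∑ s, c (h s).1) μ :=
  integrable_of_measurable_of_abs_le (measurable_sum_arm c) (M := ∑ _s : Fin t, ∑ i, |c i|)
    fun _ => (Finset.abs_sum_le_sum_abs _ _).trans <| Finset.sum_le_sum fun _ _ =>
      Finset.single_le_sum (f := fun i => |c i|) (fun _ _ => abs_nonneg _) (Finset.mem_univ _)

theorem Policy.step_apply (π : Policy K Tmax) (P : TPMAB K Tmax) (t : ℕ) (h : History K Tmax t) :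
    π.step P t h = π.choice t (observed h) ⊗ₘ P.armKernel := by
  rw [Policy.step, Kernel.compProd_apply_eq_compProd_sectR, Kernel.comap_apply]
  congr 1

theorem entropyBound_step (π : Policy K Tmax) {P P' : TPMAB K Tmax} {c : Fin K → ℝ}
    (hc : ∀ i, EntropyBound (P.law i) (P'.law i) (c i)) (t : ℕ) (h : History K Tmax t) :
    EntropyBound (π.step P t h) (π.step P' t h) (∫ y, c y.1 ∂(π.step P t h)) := by
  have hi : ∀ {Ω : Type} [MeasurableSpace Ω] (μ : Measure Ω) [IsProbabilityMeasure μ]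
      (X : Ω → Fin K), Measurable X → Integrable (fun ω => c (X ω)) μ := fun μ _ X hX =>
    integrable_of_measurable_of_abs_le ((measurable_of_finite c).comp hX) (M := ∑ i, |c i|)
      fun ω => Finset.single_le_sum (f := fun i => |c i|) (fun i _ => abs_nonneg _)
        (Finset.mem_univ _)
  rw [Policy.step_apply, Policy.step_apply,
    Measure.integral_compProd (hi _ _ measurable_fst)]
  have := (EntropyBound.refl (π.choice t (observed h))).compProd (κ := P.armKernel)
    (η := P'.armKernel) (hi _ _ measurable_id) hc
  simpa using this

theorem historyLaw_succ_integral_sum_arm (π : Policy K Tmax) (P : TPMAB K Tmax) (c : Fin K → ℝ)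
    (t : ℕ) :
    ∫ h, ∑ s, c (h s).1 ∂(π.historyLaw P (t + 1)) =
      ∫ h, ∑ s, c (h s).1 ∂(π.historyLaw P t) +
        ∫ h, ∫ y, c y.1 ∂(π.step P t h) ∂(π.historyLaw P t) := by
  have hb : ∀ y : Fin K × (Fin Tmax → ℝ), |c y.1| ≤ ∑ i, |c i| := fun y =>
    Finset.single_le_sum (f := fun i => |c i|) (fun i _ => abs_nonneg _) (Finset.mem_univ _)
  have hm : Measurable fun y : Fin K × (Fin Tmax → ℝ) => c y.1 :=
    (measurable_of_finite c).comp measurable_fst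
  have h1 : Integrable (fun p : History K Tmax t × (Fin K × (Fin Tmax → ℝ)) => ∑ s, c (p.1 s).1)
      (π.historyLaw P t ⊗ₘ π.step P t) := by
    have := (integrable_sum_arm c ((π.historyLaw P t ⊗ₘ π.step P t).map Prod.fst))
    exact this.comp_measurable measurable_fst
  have h2 : Integrable (fun p : History K Tmax t × (Fin K × (Fin Tmax → ℝ)) => c p.2.1)
      (π.historyLaw P t ⊗ₘ π.step P t) :=
    integrable_of_measurable_of_abs_le (hm.comp measurable_snd) fun p => hb p.2
  rw [Policy.historyLaw, integral_map (measurable_snoc t).aemeasurable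
    (measurable_sum_arm c).aestronglyMeasurable]
  simp only [Fin.sum_univ_castSucc, Fin.snoc_castSucc, Fin.snoc_last]
  rw [integral_add h1 h2, Measure.integral_compProd h1, Measure.integral_compProd h2]
  simp

/-- The information gained about the alternative in `T` rounds is at most the sum over the rounds
of that carried by the reward vector of the pulled arm. Delayed observation plays no role: the
policy acts on both problems through the same kernels, so its choices carry no information. -/
theorem entropyBound_historyLaw (π : Policy K Tmax) {P P' : TPMAB K Tmax} {c : Fin K → ℝ}
    (hc : ∀ i, EntropyBound (P.law i) (P'.law i) (c i)) (T : ℕ) :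
    EntropyBound (π.historyLaw P T) (π.historyLaw P' T)
      (∫ h, ∑ t, c (h t).1 ∂(π.historyLaw P T)) := by
  induction T with
  | zero => simpa [Policy.historyLaw] using EntropyBound.refl _
  | succ t ih =>
    rw [historyLaw_succ_integral_sum_arm, Policy.historyLaw, Policy.historyLaw]
    refine (ih.compProd ?_ fun h => entropyBound_step π hc t h).map (measurable_snoc t)
    have hm : Measurable fun y : Fin K × (Fin Tmax → ℝ) => c y.1 :=
      (measurable_of_finite c).comp measurable_fst
    have hb : ∀ y : Fin K × (Fin Tmax → ℝ), |c y.1| ≤ ∑ i, |c i| := fun y =>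
      Finset.single_le_sum (f := fun i => |c i|) (fun i _ => abs_nonneg _) (Finset.mem_univ _)
    exact (integrable_of_measurable_of_abs_le (μ := π.historyLaw P t ⊗ₘ π.step P t)
      (hm.comp measurable_snd) fun p => hb p.2).integral_compProd

/-! ### Numbers of pulls and regret -/

theorem integral_sum_arm (π : Policy K Tmax) (P : TPMAB K Tmax) (c : Fin K → ℝ) (T : ℕ) :
    ∫ h, ∑ t, c (h t).1 ∂(π.historyLaw P T) = ∑ i, c i * π.expectedPulls P i T := by
  have e : ∀ h : History K Tmax T, ∑ t, c (h t).1 =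
      ∑ i, c i * ∑ t : Fin T, (if (h t).1 = i then (1 : ℝ) else 0) := by
    intro h
    simp only [Finset.mul_sum]
    rw [Finset.sum_comm]
    simp
  simp only [e]
  rw [integral_finsetSum]
  · simp only [integral_const_mul, Policy.expectedPulls]
  · intro i _
    exact (integrable_sum_arm (fun a => if a = i then (1 : ℝ) else 0) _).const_mul _

theorem sum_expectedPulls (π : Policy K Tmax) (P : TPMAB K Tmax) (T : ℕ) :
    ∑ i, π.expectedPulls P i T = T := by
  have h := integral_sum_arm π P (fun _ => 1) T
  simpa using h.symm

theorem expectedPulls_nonneg (π : Policy K Tmax) (P : TPMAB K Tmax) (i : Fin K) (T : ℕ) :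
    0 ≤ π.expectedPulls P i T :=
  integral_nonneg fun h => Finset.sum_nonneg fun t _ => by split_ifs <;> simp

theorem regret_eq_sum (π : Policy K Tmax) (P : TPMAB K Tmax) (T : ℕ) :
    π.regret P T = ∑ i, (P.bestMean - P.mean i) * π.expectedPulls P i T := by
  rw [Policy.regret, integral_sum_arm π P P.mean T, ← sum_expectedPulls π P T]
  simp only [sub_mul, Finset.sum_sub_distrib, Finset.sum_mul]
  congr 1
  exact Finset.sum_congr rfl fun i _ => mul_comm _ _

theorem TPMAB.mean_le_bestMean (P : TPMAB K Tmax) (i : Fin K) : P.mean i ≤ P.bestMean :=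
  le_ciSup (Set.finite_range _).bddAbove i

theorem TPMAB.cap_nonneg (P : TPMAB K Tmax) (i : Fin K) (j : Fin Tmax) : 0 ≤ P.cap i j := by
  obtain ⟨x, hx⟩ := (P.ae_mem_Icc i).exists
  exact (hx j).1.trans (hx j).2

theorem TPMAB.mean_nonneg (P : TPMAB K Tmax) (i : Fin K) : 0 ≤ P.mean i := by
  refine integral_nonneg_of_ae ?_
  filter_upwards [P.ae_mem_Icc i] with x hx
  exact Finset.sum_nonneg fun j _ => (hx j).1

theorem TPMAB.mean_le_maxReward (P : TPMAB K Tmax) (i : Fin K) : P.mean i ≤ P.maxReward i := by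
  have hle : ∀ᵐ x ∂(P.law i), ∑ j, x j ≤ P.maxReward i := by
    filter_upwards [P.ae_mem_Icc i] with x hx
    exact Finset.sum_le_sum fun j _ => (hx j).2
  have hint : Integrable (fun x : Fin Tmax → ℝ => ∑ j, x j) (P.law i) := by
    refine Integrable.of_bound (C := P.maxReward i) (by fun_prop) ?_
    filter_upwards [P.ae_mem_Icc i, hle] with x hx hle
    rwa [Real.norm_of_nonneg (Finset.sum_nonneg fun j _ => (hx j).1)]
  have h := integral_mono_ae hint (integrable_const (P.maxReward i)) hle
  simpa [TPMAB.mean] using h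

theorem TPMAB.bestMean_le_maxRewardSup (P : TPMAB K Tmax) : P.bestMean ≤ P.maxRewardSup :=
  ciSup_mono (Set.finite_range _).bddAbove P.mean_le_maxReward

/-! ### Change of measure for a single arm -/

/-- If the two problems differ only in arm `i`, telling them apart through the fraction of rounds
in which `i` is pulled requires pulling it: the entropy inequality for the test function
`l * (1 - N / T)`, `N` the number of pulls, with the exponential bounded by its chord. -/
theorem mul_one_sub_expectedPulls_le (π : Policy K Tmax) {P P' : TPMAB K Tmax} {i : Fin K} {D : ℝ}
    (hne : ∀ j, j ≠ i → P'.law j = P.law j) (hD : EntropyBound (P.law i) (P'.law i) D)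
    {T : ℕ} (hT : 0 < T) {l : ℝ} (hl : 0 ≤ l) :
    l * (1 - π.expectedPulls P i T / T) ≤
      Real.log (1 + (Real.exp l - 1) * (1 - π.expectedPulls P' i T / T)) +
        D * π.expectedPulls P i T := by
  have hT' : (0 : ℝ) < T := by exact_mod_cast hT
  have hc : ∀ j, EntropyBound (P.law j) (P'.law j) (if j = i then D else 0) := by
    intro j
    split_ifs with hj
    · exact hj ▸ hD
    · rw [hne j hj]; exact EntropyBound.refl _
  have hE := entropyBound_historyLaw π hc T
  rw [integral_sum_arm π P (fun j => if j = i then D else 0)] at hE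
  simp only [ite_mul, zero_mul, Finset.sum_ite_eq', Finset.mem_univ, if_true] at hE
  set N : History K Tmax T → ℝ := fun h => ∑ t : Fin T, (if (h t).1 = i then (1 : ℝ) else 0)
    with hN
  have hNm : Measurable N := measurable_sum_arm (fun a => if a = i then (1 : ℝ) else 0)
  have hN0 : ∀ h, 0 ≤ N h := fun h => Finset.sum_nonneg fun t _ => by split_ifs <;> simp
  have hN1 : ∀ h, N h ≤ T := fun h => by
    have : N h ≤ ∑ _t : Fin T, (1 : ℝ) := Finset.sum_le_sum fun t _ => by split_ifs <;> simp
    simpa using this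
  have hNi : ∀ Q : TPMAB K Tmax, Integrable N (π.historyLaw Q T) := fun Q =>
    integrable_sum_arm (fun a => if a = i then (1 : ℝ) else 0) _
  have hy0 : ∀ h, 0 ≤ 1 - N h / T := fun h => by
    have := (div_le_one hT').2 (hN1 h)
    linarith
  have hy1 : ∀ h, 1 - N h / T ≤ 1 := fun h => by
    have := div_nonneg (hN0 h) hT'.le
    linarith
  have hyi : ∀ Q : TPMAB K Tmax, Integrable (fun h => 1 - N h / T) (π.historyLaw Q T) := fun Q =>
    (integrable_const _).sub ((hNi Q).div_const _)
  have hyint : ∀ Q : TPMAB K Tmax, ∫ h, (1 - N h / T) ∂(π.historyLaw Q T) =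
      1 - π.expectedPulls Q i T / T := fun Q => by
    rw [integral_sub (integrable_const _) ((hNi Q).div_const _), integral_div]
    simp [Policy.expectedPulls, hN]
  have hfm : Measurable fun h => l * (1 - N h / T) := by fun_prop
  have hfb : ∀ h, |l * (1 - N h / T)| ≤ l := fun h => by
    rw [abs_of_nonneg (mul_nonneg hl (hy0 h))]
    exact mul_le_of_le_one_right hl (hy1 h)
  have h1 := hE _ hfm ⟨l, hfb⟩
  rw [integral_const_mul, hyint] at h1
  refine h1.trans (add_le_add_left ?_ _)
  refine Real.log_le_log
    ((Real.exp_pos _).trans_le (exp_neg_le_integral_exp hfm hfb)) ?_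
  have hchord : ∀ h, Real.exp (l * (1 - N h / T)) ≤ 1 + (Real.exp l - 1) * (1 - N h / T) := by
    intro h
    have hcx := convexOn_exp.2 (Set.mem_univ 0) (Set.mem_univ l) (sub_nonneg.2 (hy1 h)) (hy0 h)
      (by ring)
    simp only [smul_eq_mul, mul_zero, zero_add, Real.exp_zero] at hcx
    rw [mul_comm l]
    linarith
  have h2 := integral_mono (μ := π.historyLaw P' T) (integrable_exp_of_abs_le hfm hfb)
    ((integrable_const 1).add ((hyi P').const_mul (Real.exp l - 1))) hchord
  rw [integral_add' (integrable_const 1) ((hyi P').const_mul (Real.exp l - 1)),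
    integral_const_mul, hyint] at h2
  simpa using h2

/-- Logarithmic growth of the number of pulls, when arm `i` is suboptimal in `P` and is the unique
optimal arm in `P'`: `l = (1 - a) * log T` is the largest exponent for which the exponential moment
under `P'`, where the other arms are pulled `o(T ^ a)` times, stays bounded. -/
theorem eventually_le_mul_expectedPulls (π : Policy K Tmax) {P P' : TPMAB K Tmax} {i : Fin K}
    {D a : ℝ} (hne : ∀ j, j ≠ i → P'.law j = P.law j)
    (hD : EntropyBound (P.law i) (P'.law i) D) (ha0 : 0 < a) (ha1 : a < 1)
    (hP : (fun T : ℕ => π.expectedPulls P i T) =o[atTop] fun T : ℕ => (T : ℝ) ^ a)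
    (hP' : ∀ j, j ≠ i →
      (fun T : ℕ => π.expectedPulls P' j T) =o[atTop] fun T : ℕ => (T : ℝ) ^ a) :
    ∀ᶠ T : ℕ in atTop, ((1 - a) * (1 - a) - a) * Real.log T ≤ D * π.expectedPulls P i T := by
  have hlog : Tendsto (fun T : ℕ => Real.log T) atTop atTop :=
    Real.tendsto_log_atTop.comp tendsto_natCast_atTop_atTop
  have hsum : (fun T : ℕ => ∑ j with j ≠ i, π.expectedPulls P' j T) =o[atTop]
      fun T : ℕ => (T : ℝ) ^ a := by
    have h := IsLittleO.sum (s := Finset.univ.filter (· ≠ i)) fun j hj =>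
      hP' j (Finset.mem_filter.1 hj).2
    exact h.congr_left fun T => Finset.sum_apply T _ _
  have h1 := hsum.bound one_pos
  have h2 := hP.bound ha0
  filter_upwards [h1, h2, eventually_ge_atTop 1, hlog.eventually_ge_atTop (Real.log 2 / a)]
    with T h1 h2 hT hL
  have hT1 : (1 : ℝ) ≤ T := by exact_mod_cast hT
  have hT0 : (0 : ℝ) < T := by linarith
  have hL0 : 0 ≤ Real.log T := Real.log_nonneg hT1
  have hpa : (T : ℝ) ^ a ≤ T := by
    simpa using Real.rpow_le_rpow_of_exponent_le hT1 ha1.le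
  have hTa : 0 < (T : ℝ) ^ a := Real.rpow_pos_of_pos hT0 a
  rw [Real.norm_of_nonneg (Finset.sum_nonneg fun j _ => expectedPulls_nonneg π P' j T),
    Real.norm_of_nonneg hTa.le, one_mul] at h1
  rw [Real.norm_of_nonneg (expectedPulls_nonneg π P i T), Real.norm_of_nonneg hTa.le] at h2
  have hsplit : ∑ j with j ≠ i, π.expectedPulls P' j T = T - π.expectedPulls P' i T := by
    rw [← sum_expectedPulls π P' T, Finset.filter_ne', ← Finset.sum_erase_add _ _
      (Finset.mem_univ i)]
    ring
  rw [hsplit] at h1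
  have hmain := mul_one_sub_expectedPulls_le π hne hD hT
    (l := (1 - a) * Real.log T) (mul_nonneg (by linarith) hL0)
  have hexp : Real.exp ((1 - a) * Real.log T) = T / (T : ℝ) ^ a := by
    rw [mul_comm, ← Real.rpow_def_of_pos hT0, Real.rpow_sub hT0, Real.rpow_one]
  have hfrac : 0 ≤ 1 - π.expectedPulls P' i T / T := by
    rw [sub_nonneg, div_le_one hT0, ← sum_expectedPulls π P' T]
    exact Finset.single_le_sum (f := fun j => π.expectedPulls P' j T)
      (fun j _ => expectedPulls_nonneg π P' j T) (Finset.mem_univ i)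
  have hexp1 : 1 ≤ T / (T : ℝ) ^ a := (one_le_div hTa).2 hpa
  have hlog2 : Real.log (1 + (Real.exp ((1 - a) * Real.log T) - 1) *
      (1 - π.expectedPulls P' i T / T)) ≤ Real.log 2 := by
    rw [hexp]
    have hnn : 0 ≤ (T / (T : ℝ) ^ a - 1) * (1 - π.expectedPulls P' i T / T) :=
      mul_nonneg (by linarith) hfrac
    refine Real.log_le_log (by linarith) ?_
    have e : T / (T : ℝ) ^ a * (1 - π.expectedPulls P' i T / T) =
        (T - π.expectedPulls P' i T) / (T : ℝ) ^ a := by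
      field_simp
    have : (T - π.expectedPulls P' i T) / (T : ℝ) ^ a ≤ 1 := (div_le_one hTa).2 h1
    rw [sub_mul, e]
    linarith
  have hEa : π.expectedPulls P i T / T ≤ a := by
    rw [div_le_iff₀ hT0]
    exact h2.trans (mul_le_mul_of_nonneg_left hpa ha0.le)
  have hla : Real.log 2 ≤ a * Real.log T := by
    rw [div_le_iff₀ ha0] at hL
    linarith
  have h3 : (1 - a) * Real.log T * (1 - a) ≤
      (1 - a) * Real.log T * (1 - π.expectedPulls P i T / T) :=
    mul_le_mul_of_nonneg_left (by linarith) (mul_nonneg (by linarith) hL0)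
  linarith

end Interaction

/-! ### The lower bound -/

section LowerBound

variable {K Tmax α : ℕ}

/-- The alternative problem: the law of the scaled Bernoulli arm `i` is replaced by the law of the
same form with success probability `q`, all other arms and all maximum rewards are kept. -/
theorem exists_alternative (hdvd : α ∣ Tmax) {P : TPMAB K Tmax} (hP : P.AlphaSmooth α) {i : Fin K}
    (hi : P.IsScaledBernoulliArm α i) (hR : 0 < P.maxRewardSup) {q : ℝ} (hq0 : 0 < q)
    (hq1 : q < 1) :
    ∃ P' ∈ TPMAB.alphaSmoothClass α P.cap, (∀ j, j ≠ i → P'.law j = P.law j) ∧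
      P'.mean i = q * P.maxRewardSup ∧
      EntropyBound (P.law i) (P'.law i) (α * klReal (P.mean i / P.maxRewardSup) q) := by
  obtain ⟨hα1, hαT, -, hsm⟩ := hP
  have hα0 : (0 : ℝ) < α := by exact_mod_cast hα1
  have hB : P.maxRewardSup / α ≠ 0 := by positivity
  have hcap : ∀ k : Fin α, blockSum α k (P.cap i) = P.maxRewardSup / α := fun k => by
    rw [(hsm i).2 k, hi.1]
  have hp0 : 0 ≤ P.mean i / P.maxRewardSup := div_nonneg (P.mean_nonneg i) hR.le
  have hp1 : P.mean i / P.maxRewardSup ≤ 1 :=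
    div_le_one_of_le₀ (hi.1 ▸ P.mean_le_maxReward i) hR.le
  have hlaw := eq_bernoulliBlockLaw hdvd hcap hB (P.ae_mem_Icc i) (hsm i).1 hi.2
  let law' : Fin K → Measure (Fin Tmax → ℝ) := fun j =>
    if j = i then bernoulliBlockLaw hdvd (P.cap i) (P.maxRewardSup / α) q else P.law j
  have hlaw_i : law' i = bernoulliBlockLaw hdvd (P.cap i) (P.maxRewardSup / α) q := if_pos rfl
  have hlaw_ne : ∀ j, j ≠ i → law' j = P.law j := fun j hj => if_neg hj
  let P' : TPMAB K Tmax :=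
    { cap := P.cap
      law := law'
      isProbabilityMeasure_law := fun j => by
        rcases eq_or_ne j i with rfl | hj
        · rw [hlaw_i]; exact isProbabilityMeasure_bernoulliBlockLaw hdvd hq0.le hq1.le
        · rw [hlaw_ne j hj]; infer_instance
      ae_mem_Icc := fun j => by
        rcases eq_or_ne j i with rfl | hj
        · rw [hlaw_i]; exact ae_bernoulliBlockLaw_mem_Icc hdvd (P.cap_nonneg j) hq0.le hq1.le
        · rw [hlaw_ne j hj]; exact P.ae_mem_Icc j }
  refine ⟨P', ⟨⟨hα1, hαT, hdvd, fun j => ⟨?_, (hsm j).2⟩⟩, rfl⟩, hlaw_ne, ?_, ?_⟩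
  · change iIndepFun _ (law' j)
    rcases eq_or_ne j i with rfl | hj
    · rw [hlaw_i]; exact iIndepFun_blockSum_bernoulliBlockLaw hdvd hcap hq0.le hq1.le
    · rw [hlaw_ne j hj]; exact (hsm j).1
  · change ∫ x, ∑ j, x j ∂(law' i) = _
    rw [hlaw_i, integral_sum_of_map_blockSum hdvd hq0.le hq1.le
      (map_blockSum_bernoulliBlockLaw_apply hdvd hcap hq0.le hq1.le)]
    field_simp
  · change EntropyBound (P.law i) (law' i) _
    rw [hlaw_i, hlaw]
    exact entropyBound_bernoulliBlockLaw hdvd hp0 hp1 hq0 hq1 _ _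

/-- Asymptotic lower bound on the number of pulls of a suboptimal scaled Bernoulli arm, when the
optimal mean is not extremal. The success probability of the alternative is moved from the optimal
one towards `1` by the same parameter `a` that controls the exponent of `T`. -/
theorem eventually_le_expectedPulls_div_log (hdvd : α ∣ Tmax) {P : TPMAB K Tmax}
    (hP : P.AlphaSmooth α) {i : Fin K} (hsub : P.mean i < P.bestMean)
    (hi : P.IsScaledBernoulliArm α i) {π : Policy K Tmax}
    (hπ : π.UniformlyEfficientOn (TPMAB.alphaSmoothClass α P.cap))
    (hlt : P.bestMean < P.maxRewardSup) {b : ℝ}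
    (hb : b < 1 / (α * klReal (P.mean i / P.maxRewardSup) (P.bestMean / P.maxRewardSup))) :
    ∀ᶠ T : ℕ in atTop, b ≤ π.expectedPulls P i T / Real.log T := by
  have hα0 : (0 : ℝ) < α := by exact_mod_cast hP.1
  have hbest : 0 < P.bestMean := (P.mean_nonneg i).trans_lt hsub
  have hR : 0 < P.maxRewardSup := hbest.trans hlt
  set p := P.mean i / P.maxRewardSup with hp
  set q := P.bestMean / P.maxRewardSup with hq
  have hp0 : 0 ≤ p := div_nonneg (P.mean_nonneg i) hR.le
  have hpq : p < q := div_lt_div_of_pos_right hsub hR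
  have hq0 : 0 < q := div_pos hbest hR
  have hq1 : q < 1 := (div_lt_one hR).2 hlt
  have hkl : 0 < klReal p q := klReal_pos hp0 hpq hq1
  -- the exponent `a` and the success probability `q + a * (1 - q)` of the alternative
  have hcont : ContinuousAt (fun a : ℝ => ((1 - a) * (1 - a) - a) /
      (α * klReal p (q + a * (1 - q)))) 0 := by
    have h1 : ContinuousAt (fun a : ℝ => klReal p (q + a * (1 - q))) 0 := by
      refine ContinuousAt.comp (f := fun a : ℝ => q + a * (1 - q)) (g := klReal p) ?_ (by fun_prop)
      simpa using continuousAt_klReal hq0 hq1 (hpq.trans hq1)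
    refine ContinuousAt.div (by fun_prop) (continuousAt_const.mul h1) ?_
    simp only [zero_mul, add_zero]
    positivity
  have hev : ∀ᶠ a : ℝ in nhdsWithin 0 (Set.Ioi 0), b < ((1 - a) * (1 - a) - a) /
      (α * klReal p (q + a * (1 - q))) := by
    refine (hcont.eventually (lt_mem_nhds ?_)).filter_mono nhdsWithin_le_nhds
    simpa using hb
  obtain ⟨a, hab, ha0, ha1⟩ := (hev.and (Ioo_mem_nhdsGT (zero_lt_one' ℝ))).exists
  have hqq' : q < q + a * (1 - q) := by nlinarith
  have hq'1 : q + a * (1 - q) < 1 := by nlinarith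
  set q' := q + a * (1 - q) with hq'
  have hkl' : 0 < klReal p q' := klReal_pos hp0 (hpq.trans hqq') hq'1
  obtain ⟨P', hP'mem, hne, hmean, hD⟩ :=
    exists_alternative hdvd hP hi hR (hq0.trans hqq') hq'1
  have hmean_gt : P.bestMean < P'.mean i := by
    rw [hmean]
    calc P.bestMean = q * P.maxRewardSup := by rw [hq]; field_simp
      _ < q' * P.maxRewardSup := mul_lt_mul_of_pos_right hqq' hR
  have hsub' : ∀ j, j ≠ i → P'.mean j < P'.bestMean := fun j hj => by
    have e : P'.mean j = P.mean j := by rw [TPMAB.mean, TPMAB.mean, hne j hj]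
    rw [e]
    exact (P.mean_le_bestMean j).trans_lt (hmean_gt.trans_le (P'.mean_le_bestMean i))
  have hmain := eventually_le_mul_expectedPulls π hne hD ha0 ha1
    (hπ P ⟨hP, rfl⟩ i hsub a ha0 ha1) fun j hj => hπ P' hP'mem j (hsub' j hj) a ha0 ha1
  filter_upwards [hmain, eventually_ge_atTop 2] with T hT hT2
  have hL : 0 < Real.log T := Real.log_pos (by exact_mod_cast hT2)
  have hDpos : 0 < α * klReal p q' := by positivity
  refine hab.le.trans ?_
  rw [div_le_div_iff₀ hDpos hL]
  linarith

/-- The contribution `c` of a suboptimal arm to the lower bound is finite, and it is an asymptotic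
lower bound for the part of the regret due to that arm. If the optimal mean equals the largest
maximum reward, the divergence is infinite and `c = 0`. -/
theorem eventually_sub_le_regretTerm (hdvd : α ∣ Tmax) {P : TPMAB K Tmax}
    (hP : P.AlphaSmooth α) {i : Fin K} (hsub : P.mean i < P.bestMean)
    (hi : P.IsScaledBernoulliArm α i) {π : Policy K Tmax}
    (hπ : π.UniformlyEfficientOn (TPMAB.alphaSmoothClass α P.cap)) :
    ∃ c : ℝ, 0 ≤ c ∧ ENNReal.ofReal (P.bestMean - P.mean i) /
        (α * bernoulliKL (P.mean i / P.maxRewardSup) (P.bestMean / P.maxRewardSup)) =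
          ENNReal.ofReal c ∧
      ∀ ε > 0, ∀ᶠ T : ℕ in atTop,
        c - ε ≤ (P.bestMean - P.mean i) * π.expectedPulls P i T / Real.log T := by
  have hα0 : (0 : ℝ) < α := by exact_mod_cast hP.1
  have hbest : 0 < P.bestMean := (P.mean_nonneg i).trans_lt hsub
  have hR : 0 < P.maxRewardSup := hbest.trans_le P.bestMean_le_maxRewardSup
  have hΔ : 0 < P.bestMean - P.mean i := sub_pos.2 hsub
  have hp0 : 0 ≤ P.mean i / P.maxRewardSup := div_nonneg (P.mean_nonneg i) hR.le
  have hpq : P.mean i / P.maxRewardSup < P.bestMean / P.maxRewardSup :=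
    div_lt_div_of_pos_right hsub hR
  rcases P.bestMean_le_maxRewardSup.eq_or_lt with heq | hlt
  · refine ⟨0, le_rfl, ?_, fun ε hε => ?_⟩
    · rw [heq, div_self hR.ne', bernoulliKL_one_right]
      · rw [ENNReal.mul_top (by exact_mod_cast hα0.ne'), ENNReal.div_top, ENNReal.ofReal_zero]
      · rwa [heq, div_self hR.ne'] at hpq
    · filter_upwards [eventually_ge_atTop 1] with T hT
      have : 0 ≤ (P.bestMean - P.mean i) * π.expectedPulls P i T / Real.log T :=
        div_nonneg (mul_nonneg hΔ.le (expectedPulls_nonneg π P i T))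
          (Real.log_nonneg (by exact_mod_cast hT))
      linarith
  · have hq1 : P.bestMean / P.maxRewardSup < 1 := (div_lt_one hR).2 hlt
    have hkl := klReal_pos hp0 hpq hq1
    set κ := klReal (P.mean i / P.maxRewardSup) (P.bestMean / P.maxRewardSup) with hκ
    refine ⟨(P.bestMean - P.mean i) / (α * κ), by positivity, ?_, fun ε hε => ?_⟩
    · rw [bernoulliKL_eq_ofReal hp0 (hpq.trans hq1).le (hp0.trans_lt hpq) hq1,
        ← ENNReal.ofReal_natCast, ← ENNReal.ofReal_mul hα0.le,
        ← ENNReal.ofReal_div_of_pos (by positivity)]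
    · have hb : 1 / (α * κ) - ε / (P.bestMean - P.mean i) < 1 / (α * κ) :=
        sub_lt_self _ (by positivity)
      filter_upwards [eventually_le_expectedPulls_div_log hdvd hP hsub hi hπ hlt hb] with T hT
      have h := mul_le_mul_of_nonneg_left hT hΔ.le
      have e : (P.bestMean - P.mean i) * (1 / (α * κ) - ε / (P.bestMean - P.mean i)) =
          (P.bestMean - P.mean i) / (α * κ) - ε := by
        field_simp
      rw [e] at h
      rwa [mul_div_assoc]

theorem sum_le_liminf_regret_div_log (hdvd : α ∣ Tmax) {P : TPMAB K Tmax}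
    (hP : P.AlphaSmooth α)
    (hB : ∀ i, P.mean i < P.bestMean → P.IsScaledBernoulliArm α i) {π : Policy K Tmax}
    (hπ : π.UniformlyEfficientOn (TPMAB.alphaSmoothClass α P.cap)) :
    ((∑ i with P.mean i < P.bestMean,
        ENNReal.ofReal (P.bestMean - P.mean i) /
          (α * bernoulliKL (P.mean i / P.maxRewardSup) (P.bestMean / P.maxRewardSup)) :
        ℝ≥0∞) : EReal) ≤
      liminf (fun T : ℕ => ((π.regret P T / Real.log T : ℝ) : EReal)) atTop := by
  choose! c hc0 hc hev using fun (i : Fin K) (hi : P.mean i < P.bestMean) =>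
    eventually_sub_le_regretTerm hdvd hP hi (hB i hi) hπ
  set S : Finset (Fin K) := Finset.univ.filter fun i => P.mean i < P.bestMean with hS
  have hmem : ∀ i ∈ S, P.mean i < P.bestMean := fun i hi => (Finset.mem_filter.1 hi).2
  rw [Finset.sum_congr rfl fun i hi => hc i (hmem i hi),
    ← ENNReal.ofReal_sum_of_nonneg fun i hi => hc0 i (hmem i hi),
    EReal.coe_ennreal_ofReal, max_eq_left (Finset.sum_nonneg fun i hi => hc0 i (hmem i hi))]
  have hreg : ∀ T, π.regret P T / Real.log T =
      ∑ i ∈ S, (P.bestMean - P.mean i) * π.expectedPulls P i T / Real.log T := by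
    intro T
    rw [regret_eq_sum, Finset.sum_div, hS]
    refine (Finset.sum_filter_of_ne fun i _ h => ?_).symm
    refine (P.mean_le_bestMean i).lt_of_ne fun e => h ?_
    rw [e]
    simp
  refine EReal.ge_of_forall_gt_iff_ge.1 fun z hz => ?_
  have hz' : ∃ δ > 0, (S.card : ℝ) * δ ≤ ∑ i ∈ S, c i - z := by
    have hpos : 0 < ∑ i ∈ S, c i - z := sub_pos.2 (by exact_mod_cast hz)
    refine ⟨(∑ i ∈ S, c i - z) / (S.card + 1), by positivity, ?_⟩
    rw [mul_div_assoc', div_le_iff₀ (by positivity)]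
    nlinarith
  obtain ⟨δ, hδ, hδz⟩ := hz'
  refine le_liminf_of_le isCobounded_ge_of_top ?_
  filter_upwards [(Finset.eventually_all S).2 fun i hi => hev i (hmem i hi) δ hδ] with T hT
  rw [EReal.coe_le_coe_iff, hreg]
  have h := Finset.sum_le_sum hT
  rw [Finset.sum_sub_distrib, Finset.sum_const, nsmul_eq_mul] at h
  linarith

end LowerBound

theorem theorem2 {K Tmax α : ℕ} (hK : 1 ≤ K) (hα : 1 ≤ α) (hT : 1 ≤ Tmax) (hdvd : α ∣ Tmax) :
    -- lower bound on every α-smooth problem whose suboptimal arms are scaled Bernoulli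
    (∀ P : TPMAB K Tmax, P.AlphaSmooth α →
      (∀ i, P.mean i < P.bestMean → P.IsScaledBernoulliArm α i) →
      ∀ π : Policy K Tmax, π.UniformlyEfficientOn (TPMAB.alphaSmoothClass α P.cap) →
        ((∑ i with P.mean i < P.bestMean,
            ENNReal.ofReal (P.bestMean - P.mean i) /
              (α * bernoulliKL (P.mean i / P.maxRewardSup) (P.bestMean / P.maxRewardSup)) :
            ℝ≥0∞) : EReal) ≤
          liminf (fun T : ℕ => ((π.regret P T / Real.log T : ℝ) : EReal)) atTop) ∧
    -- such problems exist for all values of the means and of the common maximum reward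
    (∀ (R : ℝ) (μ : Fin K → ℝ), (∀ i, μ i ∈ Set.Icc 0 R) →
      ∃ P : TPMAB K Tmax, P.AlphaSmooth α ∧ P.mean = μ ∧
        ∀ i, P.maxReward i = R ∧ P.IsScaledBernoulliArm α i) := by
  exact ⟨fun _ hP hB _ hπ => sum_le_liminf_regret_div_log hdvd hP hB hπ,
    fun _ _ hμ => exists_alphaSmooth_bernoulli hdvd hK hα hT hμ⟩
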